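/- Conventions. $\log=\log_2$. For a class $F$ of functions $X\to Y$ with $Y$ finite, the growth $G(F,\ell)$ is the supremum over $x_1,\dots,x_\ell\in X$ of the number of distinct tuples $\langle f(x_1),\dots,f(x_\ell)\rangle$, $f\in F$. The VC dimension of $F$ is the largest $h$ with $G(F,h)=2^h$ and $G(F,h+1)<2^{h+1}$ if such an $h$ exists, and $\infty$ otherwise. The dimension $\dim(F)$ is the VC dimension of $F$ if $|Y|=2$, and otherwise the graph dimension, i.e. the VC dimension of the binarised class $\{(x,y)\mapsto \mathbf 1[f(x)=y] : f\in F\}$. Given a loss $L:Y\times Y\to\{0,1\}$, a distribution $P$ on $X$ and a target $f_0:X\to Y$, the risk is $R(f)=\mathbb E_{x\sim P}[L(f(x),f_0(x))]$. The sample complexity $S(F,\epsilon,\eta)$ is the minimum $\ell$ for which there is a learning rule, mapping samples $\langle x_i,f_0(x_i)\rangle_{i\le\ell}$ to members of $F$, that for every $P$ and every measurable target $f_0$ returns, on i.i.d. $x_i\sim P$, a function $f\in F$ with $R(f)-\inf_{g\in F}R(g)\le\epsilon$ with probability at least $1-\eta$. Setting. Let $X$, $\Pi$, $\Gamma$ be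 nonempty sets and $Q$ a finite set of states, with $\Pi,\Gamma$ finite; let $a\ge 1$, $0\le m\le a$, $M\ge 1$. For $J\subseteq\{1,\dots,a\}$ with $|J|=m$ let $\pi_J:X^a\to X^m$ be the projection to the coordinates in $J$ in increasing order, and let $\pi_m^a$ be the set of all these projections. Let $\Phi$ be a nonempty class of functions $X^m\to\Pi$, $\Delta$ a nonempty finite class of semiautomata $D=\langle\Pi,Q,\delta,q_{\mathrm{init}}\rangle$ (with $\delta:Q\times\Pi\to Q$), and $\Theta$ a nonempty class of functions $Q\times X^m\to\Gamma$. For a string $u$ over $\Pi$, $D(u)$ is the state that $D$ reaches from $q_{\mathrm{init}}$ on $u$. Let $\mathcal A=\mathcal A(\Phi,\Delta,\Theta;a,m,\Pi,\Gamma)$ be the class of automata given by a set $J$ as above, $\phi\in\Phi$, $D\in\Delta$ and $\theta\in\Theta$; such an automaton implements the function $$\sigma_1\cdots\sigma_n\ \mapsto\ \theta\big(D(\phi(\pi_J(\sigma_1))\cdots\phi(\pi_J(\sigma_{n-1}))),\,\pi_J(\sigma_n)\big)$$ on nonempty strings over the alphabet $X^a$. $M$ is the maximum length of a string, so $\mathcal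 A$ is regarded as a class of functions from the strings over $X^a$ of length between $1$ and $M$ to $\Gamma$. Theorem. (i) For every $\ell\ge 0$, $G(\mathcal A,\ell)\le|\pi_m^a|\cdot|\Delta|\cdot G(\Phi,\ell M)\cdot G(\Theta,\ell)$. Now let $w=\log|\pi_m^a|+\log|\Delta|+\dim(\Phi)+\dim(\Theta)$ and assume $2\le w<\infty$. Then: (ii) $\dim(\mathcal A)\le 2w\log\big(w\,e\,M\,|\Pi|\,|\Gamma|\big)$; in particular it is finite. (iii) For fixed $\epsilon,\eta>0$, $S(\mathcal A,\epsilon,\eta)=O\big(w\log(wM|\Pi||\Gamma|)\big)$: there is a constant $K$ depending only on $\epsilon$ and $\eta$ such that $S(\mathcal A,\epsilon,\eta)\le K\,w\log(wM|\Pi||\Gamma|)$ for all data as above and every loss $L:\Gamma\times\Gamma\to\{0,1\}$. Here $X$ carries a $\sigma$-algebra, finite sets carry the discrete one, strings and tuples carry the induced ones, and $\Phi$ and $\Theta$ are assumed to satisfy the usual measurability requirement (automatic if $X$ is countable and discrete): their members are measurable, and for all $n$ and every $n$-tuple $p$ of outputs the set of $n$-tuples of inputs on which some member of the class has the output tuple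 $p$ is universally measurable. -/

import Mathlib

open MeasureTheory

noncomputable section

/-! ### Growth, dimension and sample complexity of a class of functions -/

section Learning

variable {X Y : Type*}

/-- The set of patterns of the class `F` on the sequence `x₁, …, x_ℓ`. -/
def patterns (F : Set (X → Y)) {n : ℕ} (x : Fin n → X) : Set (Fin n → Y) :=
  (fun f i => f (x i)) '' F

/-- The growth `G(F, ℓ)`: the supremum, over all sequences of `ℓ` elements, of the number of
distinct patterns. -/
def growth (F : Set (X → Y)) (n : ℕ) : ℕ∞ :=
  ⨆ x : Fin n → X, (patterns F x).encard

open Classical in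
/-- The VC dimension: the largest `h` with `G(F, h) = 2 ^ h` and `G(F, h + 1) < 2 ^ (h + 1)` if
there is such an `h`, and infinity otherwise. -/
def vcDimension (F : Set (X → Y)) : ℕ∞ :=
  if ∃ h : ℕ, growth F h = 2 ^ h ∧ growth F (h + 1) < 2 ^ (h + 1) then
    ⨆ (h : ℕ) (_ : growth F h = 2 ^ h ∧ growth F (h + 1) < 2 ^ (h + 1)), (h : ℕ∞)
  else ⊤

open Classical in
/-- The binarisation `(x, y) ↦ 1[f x = y]` of a function. -/
def binarise (f : X → Y) : X × Y → Bool := fun z => decide (f z.1 = z.2)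

open Classical in
/-- The dimension of a class with a finite codomain: the VC dimension if the codomain has two
elements, and otherwise the graph dimension, that is, the VC dimension of the binarised class. -/
def dimension (F : Set (X → Y)) : ℕ∞ :=
  if Nat.card Y = 2 then vcDimension F else vcDimension (binarise '' F)

/-- The risk `𝔼[L(f(x), f₀(x))]` of `f` for the target `f₀`, the `{0,1}`-valued loss `L` and the
distribution `P`. -/
def risk [MeasurableSpace X] (L : Y → Y → Bool) (P : Measure X) (f₀ f : X → Y) : ℝ :=
  ∫ x, (if L (f x) (f₀ x) = true then (1 : ℝ) else 0) ∂P

/-- A sample of size `n` suffices for `F` at accuracy `ε` and confidence `1 - η`: some learning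
rule, which maps labelled samples to members of `F`, returns for every distribution `P` and every
target `f₀` a function whose risk exceeds the least risk in `F` by more than `ε` with probability
at most `η`. (Where the failure event is not measurable, its outer measure is meant.) -/
def SampleSizeSuffices [MeasurableSpace X] [MeasurableSpace Y]
    (F : Set (X → Y)) (L : Y → Y → Bool) (ε η : ℝ) (n : ℕ) : Prop :=
  ∃ learn : (Fin n → X × Y) → (X → Y), (∀ z, learn z ∈ F) ∧
    ∀ (P : Measure X) [IsProbabilityMeasure P] (f₀ : X → Y), Measurable f₀ →
      (Measure.pi fun _ : Fin n => P)
        {x | ¬ ∀ g ∈ F,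
          risk L P f₀ (learn fun i => (x i, f₀ (x i))) - risk L P f₀ g ≤ ε}
        ≤ ENNReal.ofReal η

/-- The sample complexity `S(F, ε, η)`: the minimum sample size that suffices (infinity if there
is none). -/
def sampleComplexity [MeasurableSpace X] [MeasurableSpace Y]
    (F : Set (X → Y)) (L : Y → Y → Bool) (ε η : ℝ) : ℕ∞ :=
  ⨅ (n : ℕ) (_ : SampleSizeSuffices F L ε η n), (n : ℕ∞)

/-- The usual measurability requirement on a class of functions in learning theory: its members
are measurable, and so is, for every pattern, the set of the sequences on which the class realises
that pattern (universally measurable is enough). It is automatic over a countable discrete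
domain, and for a countable class of measurable functions into a finite set. -/
def WellBehaved [MeasurableSpace X] [MeasurableSpace Y] (F : Set (X → Y)) : Prop :=
  (∀ f ∈ F, Measurable f) ∧
    ∀ (n : ℕ) (p : Fin n → Y) (μ : Measure (Fin n → X)) [IsProbabilityMeasure μ],
      NullMeasurableSet {x : Fin n → X | p ∈ patterns F x} μ

end Learning

/-! ### Automata -/

/-- The strings over `A` of length at least `1` and at most `M`: pairs of an `n < M` and a
sequence of `n + 1` letters. (An automaton has no output on the empty string.) -/
abbrev Str (A : Type*) (M : ℕ) : Type _ := Σ n : Fin M, (Fin ((n : ℕ) + 1) → A)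

/-- A semiautomaton with input alphabet `A` and set of states `Q`. -/
structure Semiautomaton (A Q : Type*) where
  δ : Q × A → Q
  init : Q

/-- The state reached from the initial state on a string. -/
def Semiautomaton.run {A Q : Type*} (D : Semiautomaton A Q) (s : List A) : Q :=
  s.foldl (fun q σ => D.δ (q, σ)) D.init

/-- An automaton with input alphabet `A`, set of states `Q` and output alphabet `Γ`. -/
structure Automaton (A Q Γ : Type*) where
  core : Semiautomaton A Q
  θ : Q × A → Γ

/-- The function implemented by an automaton, on strings of length at most `M`:
`σ₁ … σₙ₊₁ ↦ θ(D(σ₁ … σₙ), σₙ₊₁)`. -/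
def Automaton.eval {A Q Γ : Type*} (𝔸 : Automaton A Q Γ) (M : ℕ) : Str A M → Γ :=
  fun s => 𝔸.θ (𝔸.core.run (List.ofFn fun i : Fin (s.1 : ℕ) => s.2 i.castSucc),
    s.2 (Fin.last (s.1 : ℕ)))

/-- The projection `π_J` of `a`-tuples to the coordinates in `J`, in increasing order. -/
def proj {X : Type*} {a m : ℕ} (J : Finset (Fin a)) (hJ : J.card = m) :
    (Fin a → X) → (Fin m → X) :=
  fun x i => x (J.orderEmbOfFin hJ i)

/-- The class `π_m^a` of all projections of `X^a` to `m` coordinates. -/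
def projections (X : Type*) (a m : ℕ) : Set ((Fin a → X) → (Fin m → X)) :=
  {p | ∃ (J : Finset (Fin a)) (hJ : J.card = m), p = proj J hJ}

/-- An automaton on the factored alphabet `X^a`, with dependency set `J` of cardinality `m`,
internal alphabet `B`, input function `φ`, states `Q`, semiautomaton `core` on the internal
letters, and output function `θ`. -/
structure FactoredAutomaton (X B Q Γ : Type*) (a m : ℕ) where
  J : Finset (Fin a)
  card_J : J.card = m
  φ : (Fin m → X) → B
  core : Semiautomaton B Q
  θ : Q × (Fin m → X) → Γ

/-- The induced automaton on `X^a`, with transition function `(q, σ) ↦ δ(q, φ(π_J(σ)))` and output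
function `(q, σ) ↦ θ(q, π_J(σ))`. -/
def FactoredAutomaton.induced {X B Q Γ : Type*} {a m : ℕ}
    (𝔸 : FactoredAutomaton X B Q Γ a m) : Automaton (Fin a → X) Q Γ where
  core :=
    { δ := fun z => 𝔸.core.δ (z.1, 𝔸.φ (proj 𝔸.J 𝔸.card_J z.2))
      init := 𝔸.core.init }
  θ := fun z => 𝔸.θ (z.1, proj 𝔸.J 𝔸.card_J z.2)

/-- The class `𝒜(Φ, Δ, Θ; a, m, B, Γ)` of automata with input function in `Φ`, semiautomaton in `Δ`
and output function in `Θ`. -/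
def automataClass {X B Q Γ : Type*} (a m : ℕ) (Φ : Set ((Fin m → X) → B))
    (Δ : Set (Semiautomaton B Q)) (Θ : Set (Q × (Fin m → X) → Γ)) :
    Set (FactoredAutomaton X B Q Γ a m) :=
  {𝔸 | 𝔸.φ ∈ Φ ∧ 𝔸.core ∈ Δ ∧ 𝔸.θ ∈ Θ}

/-- The class of functions that the automata in `𝒜(Φ, Δ, Θ; a, m, B, Γ)` implement on the strings of
length at most `M`. -/
def automataFunctions {X B Q Γ : Type*} (a m M : ℕ) (Φ : Set ((Fin m → X) → B))
    (Δ : Set (Semiautomaton B Q)) (Θ : Set (Q × (Fin m → X) → Γ)) :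
    Set (Str (Fin a → X) M → Γ) :=
  (fun 𝔸 => 𝔸.induced.eval M) '' automataClass a m Φ Δ Θ

end

section Growth

variable {X Y : Type*}

lemma encard_patterns_le_growth (F : Set (X → Y)) {n : ℕ} (x : Fin n → X) :
    (patterns F x).encard ≤ growth F n :=
  le_iSup (fun x : Fin n → X => (patterns F x).encard) x

lemma growth_le_pow [Finite Y] (F : Set (X → Y)) (n : ℕ) :
    growth F n ≤ (Nat.card Y : ℕ∞) ^ n := by
  refine iSup_le fun x => (Set.encard_le_encard (Set.subset_univ _)).trans ?_
  rw [Set.encard_univ, ENat.card_eq_coe_natCard, Nat.card_fun]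
  simp

lemma growth_ne_top [Finite Y] (F : Set (X → Y)) (n : ℕ) : growth F n ≠ ⊤ := by
  refine ne_top_of_le_ne_top ?_ (growth_le_pow F n)
  exact_mod_cast ENat.natCast_ne_top (Nat.card Y ^ n)

lemma one_le_encard_patterns {F : Set (X → Y)} (hF : F.Nonempty) {n : ℕ} (x : Fin n → X) :
    1 ≤ (patterns F x).encard :=
  Set.one_le_encard_iff_nonempty.2 (hF.image _)

lemma growth_zero {F : Set (X → Y)} (hF : F.Nonempty) : growth F 0 = 1 := by
  refine le_antisymm (iSup_le fun x => ?_) ?_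
  · exact Set.encard_le_one_iff.2 fun a b _ _ => Subsingleton.elim a b
  · exact (one_le_encard_patterns hF Fin.elim0).trans (encard_patterns_le_growth F _)

lemma growth_succ_le [Finite Y] (F : Set (X → Y)) (n : ℕ) :
    growth F (n + 1) ≤ growth F n * Nat.card Y := by
  refine iSup_le fun x => ?_
  have h : (patterns F x).encard ≤
      (patterns F (fun i : Fin n => x i.castSucc) ×ˢ (Set.univ : Set Y)).encard := by
    refine Set.encard_le_encard_of_injOn
      (f := fun p => (fun i : Fin n => p i.castSucc, p (Fin.last n))) ?_ ?_
    · rintro _ ⟨f, hf, rfl⟩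
      exact ⟨⟨f, hf, rfl⟩, trivial⟩
    · intro p _ q _ h
      simp only [Prod.mk.injEq] at h
      ext i
      refine Fin.lastCases h.2 (fun j => congrFun h.1 j) i
  rw [Set.encard_prod, Set.encard_univ, ENat.card_eq_coe_natCard] at h
  exact h.trans (mul_le_mul_left (encard_patterns_le_growth F _) _)

lemma growth_eq_two_pow_of_succ {F : Set (X → Y)} (hY : Nat.card Y = 2) {n : ℕ}
    (h : growth F (n + 1) = 2 ^ (n + 1)) : growth F n = 2 ^ n := by
  have : Finite Y := Nat.finite_of_card_ne_zero (by omega)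
  have h1 := growth_succ_le F n
  have h2 := growth_le_pow F n
  have h3 := growth_ne_top F n
  rw [h, hY] at h1
  rw [hY] at h2
  lift growth F n to ℕ using h3 with t
  norm_cast at *
  rw [pow_succ] at h1
  omega

lemma growth_eq_two_pow_of_le {F : Set (X → Y)} (hY : Nat.card Y = 2) {k n : ℕ} (hk : k ≤ n)
    (h : growth F n = 2 ^ n) : growth F k = 2 ^ k := by
  induction n, hk using Nat.le_induction with
  | base => exact h
  | succ n _ ih => exact ih (growth_eq_two_pow_of_succ hY h)

lemma growth_of_vcDimension_eq {F : Set (X → Y)} (hY : Nat.card Y = 2) {d : ℕ}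
    (h : vcDimension F = d) : growth F d = 2 ^ d ∧ growth F (d + 1) < 2 ^ (d + 1) := by
  unfold vcDimension at h
  split_ifs at h with hex
  · obtain ⟨k, hk⟩ := hex
    have : ∀ j, (growth F j = 2 ^ j ∧ growth F (j + 1) < 2 ^ (j + 1)) → j = k := by
      intro j hj
      rcases lt_trichotomy j k with hlt | heq | hlt
      · exact absurd (growth_eq_two_pow_of_le hY (Nat.succ_le_of_lt hlt) hk.1) hj.2.ne
      · exact heq
      · exact absurd (growth_eq_two_pow_of_le hY (Nat.succ_le_of_lt hlt) hj.1) hk.2.ne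
    have h2 : (⨆ (j : ℕ) (_ : growth F j = 2 ^ j ∧ growth F (j + 1) < 2 ^ (j + 1)), (j : ℕ∞)) = k :=
      le_antisymm (iSup₂_le fun j hj => by rw [this j hj])
        (le_iSup₂ (f := fun (j : ℕ) (_ : growth F j = 2 ^ j ∧ growth F (j + 1) < 2 ^ (j + 1)) =>
          (j : ℕ∞)) k hk)
    rw [h2] at h
    have : k = d := by exact_mod_cast h
    exact this ▸ hk
  · exact absurd h (ENat.top_ne_natCast d)

lemma growth_of_vcDimension_eq_top {F : Set (X → Y)} (hF : F.Nonempty) (hY : Nat.card Y = 2)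
    (h : vcDimension F = ⊤) (n : ℕ) : growth F n = 2 ^ n := by
  have : Finite Y := Nat.finite_of_card_ne_zero (by omega)
  by_contra hn
  have hlt : growth F n < 2 ^ n := lt_of_le_of_ne (by simpa [hY] using growth_le_pow F n) hn
  have hex : ∃ h : ℕ, growth F h = 2 ^ h ∧ growth F (h + 1) < 2 ^ (h + 1) := by
    clear hn
    induction n with
    | zero => simp [growth_zero hF] at hlt
    | succ n ih =>
      by_cases hn : growth F n = 2 ^ n
      · exact ⟨n, hn, hlt⟩
      · exact ih (lt_of_le_of_ne (by simpa [hY] using growth_le_pow F n) hn)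
  obtain ⟨k, hk⟩ := hex
  rw [vcDimension, if_pos ⟨k, hk⟩] at h
  have hle : (⨆ (j : ℕ) (_ : growth F j = 2 ^ j ∧ growth F (j + 1) < 2 ^ (j + 1)), (j : ℕ∞)) ≤ k := by
    refine iSup₂_le fun j hj => ?_
    by_contra hlt'
    have : k + 1 ≤ j := by
      rw [not_le] at hlt'
      exact_mod_cast hlt'
    exact absurd (growth_eq_two_pow_of_le hY this hj.1) hk.2.ne
  rw [h] at hle
  exact absurd (top_le_iff.1 hle) (ENat.natCast_ne_top k)

lemma growth_comp_equiv {Z : Type*} (F : Set (X → Y)) (e : Y ≃ Z) (n : ℕ) :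
    growth ((fun f => e ∘ f) '' F) n = growth F n := by
  refine iSup_congr fun x => ?_
  have : patterns ((fun f => e ∘ f) '' F) x = (fun p => e ∘ p) '' patterns F x := by
    simp only [patterns, Set.image_image]
    rfl
  rw [this, Set.InjOn.encard_image]
  exact (e.injective.comp_left).injOn

lemma growth_binarise_le (F : Set (X → Y)) (n : ℕ) : growth (binarise '' F) n ≤ growth F n := by
  classical
  refine iSup_le fun z => le_trans ?_ (encard_patterns_le_growth F fun i => (z i).1)
  have : patterns (binarise '' F) z =
      (fun (p : Fin n → Y) i => decide (p i = (z i).2)) '' patterns F fun i => (z i).1 := by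
    simp only [patterns, Set.image_image]
    ext p
    simp [binarise]
  rw [this]
  exact Set.encard_image_le _ _

lemma growth_le_growth_binarise [Finite Y] (F : Set (X → Y)) (n : ℕ) :
    growth F n ≤ growth (binarise '' F) (n * Nat.card Y) := by
  refine iSup_le fun x => ?_
  let e := Finite.equivFin Y
  refine le_trans ?_ (encard_patterns_le_growth (binarise '' F)
    fun k => (x (finProdFinEquiv.symm k).1, e.symm (finProdFinEquiv.symm k).2))
  refine Set.encard_le_encard_of_injOn (f := fun p k =>
    binarise p (((finProdFinEquiv.symm k).1 : Fin n), e.symm (finProdFinEquiv.symm k).2)) ?_ ?_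
  · rintro _ ⟨f, hf, rfl⟩
    exact ⟨_, ⟨f, hf, rfl⟩, rfl⟩
  · intro p _ q _ h
    ext i
    have := congrFun h (finProdFinEquiv (i, e (q i)))
    simpa [binarise] using this

/-- The Sauer–Shelah lemma for classes of Boolean functions. -/
lemma growth_bool_le {F : Set (X → Bool)} {d : ℕ} (hd : growth F (d + 1) < 2 ^ (d + 1)) (n : ℕ) :
    growth F n ≤ ((∑ k ∈ Finset.Iic d, n.choose k : ℕ) : ℕ∞) := by
  classical
  refine iSup_le fun x => ?_
  let S : (Fin n → Bool) → Finset (Fin n) := fun p => Finset.univ.filter fun i => p i = true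
  have hS : Function.Injective S := by
    intro p q h
    ext i
    have := Finset.ext_iff.1 h i
    simp only [S, Finset.mem_filter, Finset.mem_univ, true_and] at this
    exact Bool.eq_iff_iff.2 this
  let 𝒜 : Finset (Finset (Fin n)) := (Set.toFinite (patterns F x)).toFinset.image S
  have hcard : (patterns F x).encard = (𝒜.card : ℕ∞) := by
    rw [Finset.card_image_of_injective _ hS, (Set.toFinite (patterns F x)).encard_eq_coe_toFinset_card]
  have hvc : 𝒜.vcDim ≤ d := by
    refine Finset.sup_le fun s hs => ?_
    rw [Finset.mem_shatterer] at hs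
    by_contra! hlt
    have hfull : growth F s.card = 2 ^ s.card := by
      refine le_antisymm (by simpa using growth_le_pow F s.card) ?_
      let e := s.orderEmbOfFin rfl
      refine le_trans (le_of_eq ?_) (encard_patterns_le_growth F (x ∘ e))
      have : patterns F (x ∘ e) = Set.univ := by
        rw [Set.eq_univ_iff_forall]
        intro q
        obtain ⟨u, hu, hsu⟩ := hs (t := (Finset.univ.filter fun i => q i = true).image e) (by
          intro j hj
          obtain ⟨i, _, rfl⟩ := Finset.mem_image.1 hj
          exact Finset.orderEmbOfFin_mem s rfl i)
        obtain ⟨p, hp, rfl⟩ := Finset.mem_image.1 hu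
        rw [Set.Finite.mem_toFinset] at hp
        obtain ⟨f, hf, rfl⟩ := hp
        refine ⟨f, hf, ?_⟩
        ext i
        have := Finset.ext_iff.1 hsu (e i)
        simp only [S, Finset.mem_inter, Finset.mem_filter, Finset.mem_univ, true_and,
          Finset.mem_image, EmbeddingLike.apply_eq_iff_eq, exists_eq_right] at this
        rw [and_iff_right (Finset.orderEmbOfFin_mem s rfl i)] at this
        exact Bool.eq_iff_iff.2 this
      rw [this, Set.encard_univ, ENat.card_eq_coe_natCard, Nat.card_fun]
      simp
    exact absurd (growth_eq_two_pow_of_le (by simp) (Nat.succ_le_of_lt hlt) hfull) hd.ne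
  rw [hcard]
  have := (𝒜.card_le_card_shatterer.trans Finset.card_shatterer_le_sum_vcDim)
  rw [Fintype.card_fin] at this
  exact_mod_cast this.trans (Finset.sum_le_sum_of_subset (Finset.Iic_subset_Iic.2 hvc))

lemma sum_choose_le (n d : ℕ) : ∑ k ∈ Finset.Iic d, n.choose k ≤ (n + 1) ^ d := by
  induction d with
  | zero => simp [show Finset.Iic 0 = {0} from rfl]
  | succ d ih =>
    rw [← Nat.range_succ_eq_Iic] at *
    rw [Finset.sum_range_succ]
    have h1 : n.choose (d + 1) ≤ n * (n + 1) ^ d := by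
      calc n.choose (d + 1) ≤ n ^ (d + 1) := Nat.choose_le_pow _ _
        _ = n * n ^ d := by ring
        _ ≤ n * (n + 1) ^ d := by gcongr; omega
    calc _ ≤ (n + 1) ^ d + n * (n + 1) ^ d := add_le_add ih h1
      _ = (n + 1) ^ (d + 1) := by ring

/-- A class of dimension `d` has polynomial growth of degree `d`. -/
lemma growth_le_of_dimension_eq [Finite Y] [Nonempty Y] {F : Set (X → Y)} {d : ℕ}
    (hd : dimension F = d) {n : ℕ} (hn : 1 ≤ n) :
    growth F n ≤ (((2 * n * Nat.card Y) ^ d : ℕ) : ℕ∞) := by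
  have hY : 1 ≤ Nat.card Y := Nat.card_pos
  unfold dimension at hd
  split_ifs at hd with h2
  · let e : Y ≃ Bool := (Finite.card_eq.1 (h2.trans (by simp))).some
    have h := (growth_of_vcDimension_eq h2 hd).2
    rw [← growth_comp_equiv F e] at h ⊢
    refine (growth_bool_le h n).trans ?_
    refine Nat.cast_le.2 ((sum_choose_le n d).trans (Nat.pow_le_pow_left ?_ d))
    nlinarith
  · have h := (growth_of_vcDimension_eq (by simp) hd).2
    refine (growth_le_growth_binarise F n).trans ((growth_bool_le h _).trans ?_)
    refine Nat.cast_le.2 ((sum_choose_le _ d).trans (Nat.pow_le_pow_left ?_ d))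
    nlinarith

lemma two_pow_le_growth_of_dimension_eq {F : Set (X → Y)} {d : ℕ} (hd : dimension F = d) :
    2 ^ d ≤ growth F d := by
  unfold dimension at hd
  split_ifs at hd with h2
  · exact (growth_of_vcDimension_eq h2 hd).1.ge
  · exact (growth_of_vcDimension_eq (by simp) hd).1.ge.trans (growth_binarise_le F d)

lemma two_pow_le_growth_of_dimension_eq_top {F : Set (X → Y)} (hF : F.Nonempty)
    (hd : dimension F = ⊤) (n : ℕ) : 2 ^ n ≤ growth F n := by
  unfold dimension at hd
  split_ifs at hd with h2
  · exact (growth_of_vcDimension_eq_top hF h2 hd n).ge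
  · exact (growth_of_vcDimension_eq_top (hF.image _) (by simp) hd n).ge.trans
      (growth_binarise_le F n)

end Growth

section Automata

variable {X B Q Γ : Type*} {a m M : ℕ}

/-- The letters of a string, padded with the letter `a₀` to length `M`. -/
def Str.pad {A : Type*} {M : ℕ} (a₀ : A) (s : Str A M) (j : Fin M) : A :=
  if h : (j : ℕ) < s.1 + 1 then s.2 ⟨j, h⟩ else a₀

/-- The state reached on the first `n` letters of `b`. -/
def Semiautomaton.runPrefix (D : Semiautomaton B Q) (b : Fin M → B) (n : Fin M) : Q :=
  D.run (List.ofFn fun i : Fin (n : ℕ) => b ⟨i, i.2.trans n.2⟩)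

lemma FactoredAutomaton.run_induced_core (𝔸 : FactoredAutomaton X B Q Γ a m)
    (s : List (Fin a → X)) :
    𝔸.induced.core.run s = 𝔸.core.run (s.map fun σ => 𝔸.φ (proj 𝔸.J 𝔸.card_J σ)) := by
  simp [Semiautomaton.run, FactoredAutomaton.induced, List.foldl_map]

lemma FactoredAutomaton.eval_induced (𝔸 : FactoredAutomaton X B Q Γ a m) (a₀ : Fin a → X)
    (s : Str (Fin a → X) M) :
    𝔸.induced.eval M s =
      𝔸.θ (𝔸.core.runPrefix (fun j => 𝔸.φ (proj 𝔸.J 𝔸.card_J (s.pad a₀ j))) s.1,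
        proj 𝔸.J 𝔸.card_J (s.pad a₀ s.1)) := by
  have h1 : s.pad a₀ s.1 = s.2 (Fin.last s.1) := by
    simp only [Str.pad, Nat.lt_succ_self, dif_pos]
    rfl
  rw [Automaton.eval, run_induced_core, h1, List.map_ofFn, Semiautomaton.runPrefix]
  have h2 : ∀ i : Fin (s.1 : ℕ), s.pad a₀ ⟨i, i.2.trans s.1.2⟩ = s.2 i.castSucc := by
    intro i
    simp only [Str.pad, i.2.trans (Nat.lt_succ_self _), dif_pos]
    rfl
  simp only [h2]
  rfl

lemma mem_patterns_automataFunctions_iff (a₀ : Fin a → X) (Φ : Set ((Fin m → X) → B))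
    (Δ : Set (Semiautomaton B Q)) (Θ : Set (Q × (Fin m → X) → Γ)) {l : ℕ}
    (x : Fin l → Str (Fin a → X) M) (q : Fin l → Γ) :
    q ∈ patterns (automataFunctions a m M Φ Δ Θ) x ↔
      ∃ p ∈ projections X a m, ∃ D ∈ Δ,
        ∃ b ∈ patterns Φ (fun k : Fin (l * M) =>
          p ((x (finProdFinEquiv.symm k).1).pad a₀ (finProdFinEquiv.symm k).2)),
        q ∈ patterns Θ (fun i => (D.runPrefix (fun j => b (finProdFinEquiv (i, j))) (x i).1,
          p ((x i).pad a₀ (x i).1))) := by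
  constructor
  · rintro ⟨_, ⟨𝔸, ⟨h1, h2, h3⟩, rfl⟩, rfl⟩
    refine ⟨_, ⟨𝔸.J, 𝔸.card_J, rfl⟩, 𝔸.core, h2, _, ⟨𝔸.φ, h1, rfl⟩, 𝔸.θ, h3, ?_⟩
    ext i
    simp [FactoredAutomaton.eval_induced 𝔸 a₀]
  · rintro ⟨_, ⟨J, hJ, rfl⟩, D, hD, _, ⟨φ, hφ, rfl⟩, θ, hθ, rfl⟩
    refine ⟨_, ⟨⟨J, hJ, φ, D, θ⟩, ⟨hφ, hD, hθ⟩, rfl⟩, ?_⟩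
    ext i
    simp [FactoredAutomaton.eval_induced _ a₀]

lemma Set.Finite.encard_biUnion_le_mul {ι α : Type*} {s : Set ι} (hs : s.Finite) (f : ι → Set α)
    {c : ℕ∞} (h : ∀ i ∈ s, (f i).encard ≤ c) : (⋃ i ∈ s, f i).encard ≤ s.encard * c := by
  have h1 : (⋃ i ∈ s, f i) = ⋃ i ∈ hs.toFinset, f i := by simp
  rw [h1, hs.encard_eq_coe_toFinset_card]
  refine (hs.toFinset.set_encard_biUnion_le f).trans ((Finset.sum_le_card_nsmul _ _ c ?_).trans ?_)
  · exact fun i hi => h i (hs.mem_toFinset.1 hi)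
  · rw [nsmul_eq_mul]

lemma finite_projections (X : Type*) (a m : ℕ) : (projections X a m).Finite := by
  refine (Set.finite_range fun J : {J : Finset (Fin a) // J.card = m} =>
    (proj (X := X) J.1 J.2)).subset ?_
  rintro _ ⟨J, hJ, rfl⟩
  exact ⟨⟨J, hJ⟩, rfl⟩

lemma nonempty_projections (X : Type*) {a m : ℕ} (h : m ≤ a) : (projections X a m).Nonempty := by
  obtain ⟨J, -, hJ⟩ := Finset.exists_subset_card_eq (s := (Finset.univ : Finset (Fin a)))
    (n := m) (by simpa using h)
  exact ⟨_, J, hJ, rfl⟩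

lemma growth_automataFunctions_le [Nonempty X] [Finite B] (Φ : Set ((Fin m → X) → B))
    {Δ : Set (Semiautomaton B Q)} (hΔ : Δ.Finite) (Θ : Set (Q × (Fin m → X) → Γ)) (l : ℕ) :
    growth (automataFunctions a m M Φ Δ Θ) l ≤
      ((projections X a m).ncard : ℕ∞) * (Δ.ncard : ℕ∞) * growth Φ (l * M) * growth Θ l := by
  obtain ⟨a₀⟩ : Nonempty (Fin a → X) := inferInstance
  refine iSup_le fun x => ?_
  have h : patterns (automataFunctions a m M Φ Δ Θ) x =
      ⋃ p ∈ projections X a m, ⋃ D ∈ Δ,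
        ⋃ b ∈ patterns Φ (fun k : Fin (l * M) =>
          p ((x (finProdFinEquiv.symm k).1).pad a₀ (finProdFinEquiv.symm k).2)),
        patterns Θ (fun i => (D.runPrefix (fun j => b (finProdFinEquiv (i, j))) (x i).1,
          p ((x i).pad a₀ (x i).1))) := by
    ext q
    simp only [mem_patterns_automataFunctions_iff a₀, Set.mem_iUnion, exists_prop]
  rw [h, (finite_projections X a m).cast_ncard_eq, hΔ.cast_ncard_eq, mul_assoc, mul_assoc]
  refine (finite_projections X a m).encard_biUnion_le_mul _ fun p _ => ?_
  refine hΔ.encard_biUnion_le_mul _ fun D _ => ?_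
  refine ((Set.toFinite (patterns Φ _)).encard_biUnion_le_mul _ fun b _ =>
    encard_patterns_le_growth Θ _).trans ?_
  gcongr
  exact encard_patterns_le_growth Φ _

lemma nonempty_automataFunctions (hm : m ≤ a) {Φ : Set ((Fin m → X) → B)}
    {Δ : Set (Semiautomaton B Q)} {Θ : Set (Q × (Fin m → X) → Γ)}
    (hΦ : Φ.Nonempty) (hΔ : Δ.Nonempty) (hΘ : Θ.Nonempty) :
    (automataFunctions a m M Φ Δ Θ).Nonempty := by
  obtain ⟨_, J, hJ, -⟩ := nonempty_projections X hm
  obtain ⟨φ, hφ⟩ := hΦ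
  obtain ⟨D, hD⟩ := hΔ
  obtain ⟨θ, hθ⟩ := hΘ
  exact ⟨_, ⟨J, hJ, φ, D, θ⟩, ⟨hφ, hD, hθ⟩, rfl⟩

/-- The growth of the class of automata, in terms of the dimensions of its components. -/
lemma growth_automataFunctions_le_of_dimension [Nonempty X] [Finite B] [Finite Γ] (hM : 1 ≤ M)
    {Φ : Set ((Fin m → X) → B)} {Δ : Set (Semiautomaton B Q)} {Θ : Set (Q × (Fin m → X) → Γ)}
    (hΦ : Φ.Nonempty) (hΔ : Δ.Nonempty) (hΔf : Δ.Finite) (hΘ : Θ.Nonempty)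
    {h g : ℕ} (hh : dimension Φ = h) (hg : dimension Θ = g) {l : ℕ} (hl : 1 ≤ l) :
    growth (automataFunctions a m M Φ Δ Θ) l ≤
      (((projections X a m).ncard * Δ.ncard *
        (2 * l * (M * Nat.card B * Nat.card Γ)) ^ (h + g) : ℕ) : ℕ∞) := by
  obtain ⟨x₀⟩ : Nonempty (Fin m → X) := inferInstance
  have hB : Nonempty B := ⟨hΦ.some x₀⟩
  have hQ : Nonempty Q := ⟨hΔ.some.init⟩
  have hΓ : Nonempty Γ := ⟨hΘ.some (hQ.some, x₀)⟩
  have hB' : 1 ≤ Nat.card B := Nat.card_pos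
  have hΓ' : 1 ≤ Nat.card Γ := Nat.card_pos
  have h1 := growth_le_of_dimension_eq hh (n := l * M) (Nat.mul_pos hl hM)
  have h2 := growth_le_of_dimension_eq hg hl
  refine (growth_automataFunctions_le Φ hΔf Θ l).trans ((mul_le_mul' (mul_le_mul' le_rfl h1) h2).trans ?_)
  norm_cast
  rw [pow_add, mul_assoc _ (_ ^ h) (_ ^ g)]
  refine Nat.mul_le_mul le_rfl (Nat.mul_le_mul (Nat.pow_le_pow_left ?_ _)
    (Nat.pow_le_pow_left ?_ _))
  · calc 2 * (l * M) * Nat.card B = 2 * l * (M * Nat.card B * 1) := by ring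
      _ ≤ _ := by gcongr
  · calc 2 * l * Nat.card Γ = 2 * l * (1 * 1 * Nat.card Γ) := by ring
      _ ≤ _ := by gcongr

end Automata

section UniformConvergence

open ProbabilityTheory

/-- The sign of a Boolean. -/
def boolSign (b : Bool) : ℝ := if b then 1 else -1

lemma sum_exp_boolSign_le {n : ℕ} (c : Fin n → ℝ) (hc : ∀ i, |c i| ≤ 1) (t : ℝ) :
    ∑ σ : Fin n → Bool, Real.exp (t * ∑ i, boolSign (σ i) * c i) ≤
      2 ^ n * Real.exp (n * t ^ 2 / 2) := by
  have h1 : ∀ σ : Fin n → Bool, Real.exp (t * ∑ i, boolSign (σ i) * c i) =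
      ∏ i, Real.exp (t * (boolSign (σ i) * c i)) := fun σ => by
    rw [Finset.mul_sum, Real.exp_sum]
  have h2 := Finset.prod_univ_sum (fun _ : Fin n => (Finset.univ : Finset Bool))
    (fun i b => Real.exp (t * (boolSign b * c i)))
  rw [Fintype.piFinset_univ] at h2
  simp_rw [h1]
  rw [← h2]
  have h3 : ∀ i, ∑ b : Bool, Real.exp (t * (boolSign b * c i)) ≤ 2 * Real.exp (t ^ 2 / 2) := by
    intro i
    have h4 : ∑ b : Bool, Real.exp (t * (boolSign b * c i)) = 2 * Real.cosh (t * c i) := by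
      rw [Fintype.sum_bool, Real.cosh_eq]
      simp [boolSign]
      ring
    rw [h4]
    refine mul_le_mul_of_nonneg_left ((Real.cosh_le_exp_half_sq _).trans ?_) zero_le_two
    refine Real.exp_le_exp.2 ?_
    have h5 : c i ^ 2 ≤ 1 := by
      rw [← sq_abs]
      exact pow_le_one₀ (abs_nonneg _) (hc i)
    nlinarith [sq_nonneg t]
  calc _ ≤ ∏ _i : Fin n, (2 * Real.exp (t ^ 2 / 2)) :=
        Finset.prod_le_prod (fun i _ => Finset.sum_nonneg fun _ _ => (Real.exp_pos _).le)
          fun i _ => h3 i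
    _ = _ := by
        rw [Finset.prod_const, Finset.card_univ, Fintype.card_fin, mul_pow, ← Real.exp_nat_mul]
        ring_nf

lemma card_lt_sum_boolSign_le {n : ℕ} (c : Fin n → ℝ) (hc : ∀ i, |c i| ≤ 1) {t : ℝ}
    (ht : 0 ≤ t) :
    ((Finset.univ.filter fun σ : Fin n → Bool => n * t < ∑ i, boolSign (σ i) * c i).card : ℝ) ≤
      2 ^ n * Real.exp (-(n * t ^ 2 / 2)) := by
  rw [Finset.cast_card, Finset.sum_filter]
  calc _ ≤ ∑ σ : Fin n → Bool, Real.exp (-(n * t ^ 2)) *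
          Real.exp (t * ∑ i, boolSign (σ i) * c i) := by
        refine Finset.sum_le_sum fun σ _ => ?_
        split_ifs with h
        · rw [← Real.exp_add, Real.one_le_exp_iff]
          nlinarith
        · positivity
    _ ≤ Real.exp (-(n * t ^ 2)) * (2 ^ n * Real.exp (n * t ^ 2 / 2)) := by
        rw [← Finset.mul_sum]
        exact mul_le_mul_of_nonneg_left (sum_exp_boolSign_le c hc t) (Real.exp_pos _).le
    _ = _ := by
        rw [mul_left_comm, ← Real.exp_add]
        ring_nf

/-- Hoeffding's inequality for Rademacher sums. -/
lemma card_lt_abs_sum_boolSign_le {n : ℕ} (c : Fin n → ℝ) (hc : ∀ i, |c i| ≤ 1) {t : ℝ}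
    (ht : 0 ≤ t) :
    ((Finset.univ.filter fun σ : Fin n → Bool => n * t < |∑ i, boolSign (σ i) * c i|).card : ℝ) ≤
      2 ^ n * (2 * Real.exp (-(n * t ^ 2 / 2))) := by
  have h1 := card_lt_sum_boolSign_le c hc ht
  have h2 := card_lt_sum_boolSign_le (fun i => -c i) (by simpa using hc) ht
  have h3 : (Finset.univ.filter fun σ : Fin n → Bool => n * t < |∑ i, boolSign (σ i) * c i|) ⊆
      (Finset.univ.filter fun σ : Fin n → Bool => n * t < ∑ i, boolSign (σ i) * c i) ∪
      (Finset.univ.filter fun σ : Fin n → Bool => n * t < ∑ i, boolSign (σ i) * -c i) := by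
    intro σ
    simp only [Finset.mem_filter, Finset.mem_univ, true_and, Finset.mem_union, mul_neg,
      Finset.sum_neg_distrib]
    exact lt_abs.1
  have h4 : ((Finset.univ.filter fun σ : Fin n → Bool =>
      n * t < |∑ i, boolSign (σ i) * c i|).card : ℝ) ≤ _ :=
    Nat.cast_le.2 ((Finset.card_le_card h3).trans (Finset.card_union_le _ _))
  push_cast at h4
  linarith

/-- Chebyshev's inequality for the empirical mean of a `[0,1]`-valued function. -/
lemma half_le_measure_abs_sum_sub_le {X : Type*} [MeasurableSpace X] (P : Measure X)
    [IsProbabilityMeasure P] {u : X → ℝ} (hu : Measurable u) (hu01 : ∀ x, u x ∈ Set.Icc (0 : ℝ) 1)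
    {n : ℕ} {t : ℝ} (ht : 0 < t) (hn : 1 / 2 ≤ n * t ^ 2) :
    1 / 2 ≤ (Measure.pi fun _ : Fin n => P) {x | |∑ i, u (x i) - n * ∫ y, u y ∂P| ≤ n * t} := by
  have hn0 : (0 : ℝ) < n := by
    by_contra h
    have : (n : ℝ) = 0 := le_antisymm (not_lt.1 h) (Nat.cast_nonneg n)
    rw [this] at hn
    norm_num at hn
  have hmem : MemLp u 2 P := MemLp.of_bound hu.aestronglyMeasurable 1
    (Filter.Eventually.of_forall fun x => by
      rw [Real.norm_eq_abs, abs_le]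
      exact ⟨by linarith [(hu01 x).1], (hu01 x).2⟩)
  have hmemi : ∀ i : Fin n, MemLp (fun x : Fin n → X => u (x i)) 2 (Measure.pi fun _ => P) :=
    fun i => hmem.comp_measurePreserving (measurePreserving_eval (fun _ : Fin n => P) i)
  have hvar : Var[∑ i : Fin n, fun x : Fin n → X => u (x i); Measure.pi fun _ => P] ≤ n * (1 / 4) := by
    rw [variance_sum_pi (μ := fun _ : Fin n => P) (X := fun _ => u) (fun _ => hmem)]
    rw [Finset.sum_const, Finset.card_univ, Fintype.card_fin, nsmul_eq_mul]
    refine mul_le_mul_of_nonneg_left ?_ hn0.le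
    have := variance_le_sq_of_bounded (μ := P) (X := u) (a := 0) (b := 1)
      (Filter.Eventually.of_forall hu01) hu.aemeasurable
    norm_num at this ⊢
    exact this
  have hE : ∫ x, (∑ i : Fin n, fun x : Fin n → X => u (x i)) x ∂(Measure.pi fun _ => P) =
      n * ∫ y, u y ∂P := by
    simp only [Finset.sum_apply]
    rw [integral_finsetSum _ fun i _ => (hmemi i).integrable (by norm_num)]
    simp only [integral_comp_eval (μ := fun _ : Fin n => P) hu.aestronglyMeasurable]
    simp
  have hch := meas_ge_le_variance_div_sq (memLp_finsetSum' Finset.univ fun i _ => hmemi i)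
    (mul_pos hn0 ht)
  rw [hE] at hch
  have hb : ENNReal.ofReal (Var[∑ i : Fin n, fun x : Fin n → X => u (x i); Measure.pi fun _ => P] /
      (n * t) ^ 2) ≤ 1 / 2 := by
    rw [show (1 / 2 : ENNReal) = ENNReal.ofReal (1 / 2) by
      rw [ENNReal.ofReal_div_of_pos two_pos]; simp]
    refine ENNReal.ofReal_le_ofReal ?_
    rw [div_le_iff₀ (by positivity)]
    refine hvar.trans ?_
    nlinarith
  have hcompl : {x : Fin n → X | |∑ i, u (x i) - n * ∫ y, u y ∂P| ≤ n * t}ᶜ ⊆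
      {x | n * t ≤ |(∑ i : Fin n, fun x : Fin n → X => u (x i)) x - n * ∫ y, u y ∂P|} := by
    intro x hx
    simp only [Set.mem_compl_iff, Set.mem_ofPred_eq, not_le, Finset.sum_apply] at hx ⊢
    exact hx.le
  have hmeas : MeasurableSet {x : Fin n → X | |∑ i, u (x i) - n * ∫ y, u y ∂P| ≤ n * t} := by
    refine measurableSet_le ?_ measurable_const
    refine Measurable.abs (Measurable.sub_const (Finset.measurable_fun_sum _ fun i _ => ?_) _)
    exact hu.comp (measurable_pi_apply i)
  have h1 := prob_add_prob_compl (μ := Measure.pi fun _ : Fin n => P) hmeas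
  have h2 := (measure_mono hcompl).trans (hch.trans hb)
  by_contra! hlt
  have h3 := ENNReal.add_lt_add_of_lt_of_le (ne_top_of_le_ne_top (by simp) h2) hlt h2
  rw [h1, ENNReal.add_halves] at h3
  exact lt_irrefl _ h3

end UniformConvergence

section Symmetrization

variable {X : Type*} [MeasurableSpace X]

/-- The permutation of a double sample that swaps the pairs at which `σ` is false. -/
def swapPairs {X : Type*} {n : ℕ} (σ : Fin n → Bool) (z : Fin n → X × X) : Fin n → X × X :=
  fun i => if σ i then z i else (z i).swap

lemma measurePreserving_swapPairs (P : Measure X) [IsProbabilityMeasure P] {n : ℕ}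
    (σ : Fin n → Bool) :
    MeasurePreserving (swapPairs σ) (Measure.pi fun _ : Fin n => P.prod P)
      (Measure.pi fun _ : Fin n => P.prod P) := by
  refine measurePreserving_pi (fun _ => P.prod P) (fun _ => P.prod P)
    (f := fun i y => if σ i then y else y.swap) fun i => ?_
  cases σ i
  · simpa using Measure.measurePreserving_swap (μ := P) (ν := P)
  · simpa using! MeasurePreserving.id (P.prod P)

/-- If a random swap of the pairs of any double sample lies in `E` with probability at most `r`,
then so does a random double sample. -/
lemma measure_le_of_card_swapPairs_le (P : Measure X) [IsProbabilityMeasure P] {n : ℕ}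
    {E : Set (Fin n → X × X)} (hE : NullMeasurableSet E (Measure.pi fun _ : Fin n => P.prod P))
    {r : ℝ} (hr : ∀ z, ((Set.ncard {σ : Fin n → Bool | swapPairs σ z ∈ E} : ℕ) : ℝ) ≤ 2 ^ n * r) :
    (Measure.pi fun _ : Fin n => P.prod P) E ≤ ENNReal.ofReal r := by
  classical
  set μ := Measure.pi fun _ : Fin n => P.prod P
  have h1 : (2 : ENNReal) ^ n * μ E = ∑ σ : Fin n → Bool, μ (swapPairs σ ⁻¹' E) := by
    rw [Finset.sum_congr rfl fun σ _ =>
      (measurePreserving_swapPairs P σ).measure_preimage hE]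
    simp [μ]
  have h2 : ∀ σ : Fin n → Bool, NullMeasurableSet (swapPairs σ ⁻¹' E) μ := fun σ =>
    hE.preimage (measurePreserving_swapPairs P σ).quasiMeasurePreserving
  have h3 : ∑ σ : Fin n → Bool, μ (swapPairs σ ⁻¹' E) =
      ∫⁻ z, ∑ σ : Fin n → Bool, (swapPairs σ ⁻¹' E).indicator 1 z ∂μ := by
    rw [lintegral_finsetSum']
    · exact Finset.sum_congr rfl fun σ _ => (lintegral_indicator_one₀ (h2 σ)).symm
    · exact fun σ _ => (aemeasurable_indicator_const_iff 1).2 (h2 σ)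
  have h4 : ∀ z, ∑ σ : Fin n → Bool, (swapPairs σ ⁻¹' E).indicator (1 : (Fin n → X × X) → ENNReal) z ≤
      ENNReal.ofReal (2 ^ n * r) := by
    intro z
    refine le_trans (le_of_eq ?_) (ENNReal.ofReal_le_ofReal (hr z))
    rw [ENNReal.ofReal_natCast, Set.ncard_eq_toFinset_card', Finset.cast_card]
    simp [Set.indicator_apply]
  have h5 : (2 : ENNReal) ^ n * μ E ≤ 2 ^ n * ENNReal.ofReal r := by
    rw [h1, h3]
    refine (lintegral_mono h4).trans ?_
    rw [lintegral_const, measure_univ, mul_one, ENNReal.ofReal_mul (by positivity),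
      ENNReal.ofReal_pow zero_le_two, ENNReal.ofReal_ofNat]
  exact (ENNReal.mul_le_mul_iff_right (by simp) (by simp)).1 h5

/-- Symmetrization: large deviations of the empirical means from the means are at most twice as
likely as large differences of two empirical means. -/
lemma measure_deviation_le_two_mul {ι : Type*} (P : Measure X) [IsProbabilityMeasure P]
    {u : ι → X → ℝ} (hu : ∀ f, Measurable (u f)) (hu01 : ∀ f x, u f x ∈ Set.Icc (0 : ℝ) 1)
    {n : ℕ} {t : ℝ} (ht : 0 < t) (hn : 1 / 2 ≤ n * t ^ 2) :
    (Measure.pi fun _ : Fin n => P)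
      {x | ∃ f, n * (2 * t) < |∑ i, u f (x i) - n * ∫ y, u f y ∂P|} ≤
    2 * (Measure.pi fun _ : Fin n => P.prod P)
      {z | ∃ f, n * t < |∑ i, (u f (z i).1 - u f (z i).2)|} := by
  set μ := Measure.pi fun _ : Fin n => P
  set E := {z : Fin n → X × X | ∃ f, n * t < |∑ i, (u f (z i).1 - u f (z i).2)|}
  let e := MeasurableEquiv.arrowProdEquivProdArrow X X (Fin n)
  have he : MeasurePreserving e (Measure.pi fun _ : Fin n => P.prod P) (μ.prod μ) :=
    measurePreserving_arrowProdEquivProdArrow X X (Fin n) (fun _ => P) (fun _ => P)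
  have h1 : (Measure.pi fun _ : Fin n => P.prod P) E = (μ.prod μ) (e.symm ⁻¹' E) :=
    ((he.symm e).measure_preimage_equiv E).symm
  rw [h1, ← measure_toMeasurable (e.symm ⁻¹' E)]
  set S := toMeasurable (μ.prod μ) (e.symm ⁻¹' E)
  have hS : MeasurableSet S := measurableSet_toMeasurable _ _
  have h2 : {x | ∃ f, n * (2 * t) < |∑ i, u f (x i) - n * ∫ y, u f y ∂P|} ⊆
      {x | 1 / 2 ≤ μ (Prod.mk x ⁻¹' S)} := by
    rintro x ⟨f, hf⟩
    change 1 / 2 ≤ μ (Prod.mk x ⁻¹' S)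
    refine (half_le_measure_abs_sum_sub_le P (hu f) (hu01 f) ht hn).trans
      (measure_mono fun y hy => ?_)
    refine subset_toMeasurable _ _ ?_
    refine ⟨f, ?_⟩
    change n * t < |∑ i, (u f (x i) - u f (y i))|
    rw [Finset.sum_sub_distrib]
    simp only [Set.mem_ofPred_eq] at hy
    have h3 := abs_sub_le (∑ i, u f (x i)) (∑ i, u f (y i)) (n * ∫ y, u f y ∂P)
    linarith
  refine (measure_mono (μ := μ) h2).trans ?_
  rw [Measure.prod_apply hS]
  have h3 := mul_meas_ge_le_lintegral (μ := μ) (measurable_measure_prodMk_left (ν := μ) hS) (1 / 2)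
  calc μ {x | 1 / 2 ≤ μ (Prod.mk x ⁻¹' S)}
      = 2 * (1 / 2 * μ {x | 1 / 2 ≤ μ (Prod.mk x ⁻¹' S)}) := by
        rw [← mul_assoc, one_div, ENNReal.mul_inv_cancel (by simp) (by simp), one_mul]
    _ ≤ _ := by gcongr

end Symmetrization

section Learnability

variable {X Y : Type*} [MeasurableSpace X] [MeasurableSpace Y]

lemma WellBehaved.nullMeasurableSet_preimage {Z : Type*} [MeasurableSpace Z] {F : Set (X → Y)} (hF : WellBehaved F) {n : ℕ} (p : Fin n → Y)
    (μ : Measure Z) [IsProbabilityMeasure μ] {T : Z → Fin n → X} (hT : Measurable T) :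
    NullMeasurableSet {z | p ∈ patterns F (T z)} μ := by
  have := Measure.isProbabilityMeasure_map (μ := μ) hT.aemeasurable
  exact (hF.2 n p (μ.map T)).preimage (hT.measurePreserving μ).quasiMeasurePreserving

/-- The loss of `f` for the target `f₀`, as a real number. -/
def lossAt {X Y : Type*} (L : Y → Y → Bool) (f₀ f : X → Y) (x : X) : ℝ :=
  if L (f x) (f₀ x) = true then 1 else 0

lemma lossAt_mem_Icc {X Y : Type*} (L : Y → Y → Bool) (f₀ f : X → Y) (x : X) :
    lossAt L f₀ f x ∈ Set.Icc (0 : ℝ) 1 := by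
  unfold lossAt
  split_ifs <;> simp

lemma measurable_lossAt [Finite Y] [DiscreteMeasurableSpace Y] (L : Y → Y → Bool)
    {f₀ f : X → Y} (hf₀ : Measurable f₀) (hf : Measurable f) : Measurable (lossAt L f₀ f) :=
  (Measurable.of_discrete (f := fun y : Y × Y => if L y.1 y.2 = true then (1 : ℝ) else 0)).comp
    (hf.prodMk hf₀)

/-- The double samples on which the empirical risks of some member of `F` on the two halves differ
by more than `t`. -/
def deviationSet {X Y : Type*} (F : Set (X → Y)) (L : Y → Y → Bool) (f₀ : X → Y) (n : ℕ) (t : ℝ) :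
    Set (Fin n → X × X) :=
  {z | ∃ f : F, n * t < |∑ i, (lossAt L f₀ f (z i).1 - lossAt L f₀ f (z i).2)|}

/-- The difference of the two empirical losses for the outputs `p` and the labels `q`. -/
def patternLoss {Y : Type*} (L : Y → Y → Bool) {n : ℕ} (p q : Fin (n + n) → Y) (i : Fin n) : ℝ :=
  (if L (p (Fin.castAdd n i)) (q (Fin.castAdd n i)) = true then (1 : ℝ) else 0) -
    (if L (p (Fin.natAdd n i)) (q (Fin.natAdd n i)) = true then (1 : ℝ) else 0)

lemma abs_patternLoss_le {Y : Type*} (L : Y → Y → Bool) {n : ℕ} (p q : Fin (n + n) → Y)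
    (i : Fin n) : |patternLoss L p q i| ≤ 1 := by
  unfold patternLoss
  split_ifs <;> simp

/-- A double sample as a single sequence. -/
def flatten {X : Type*} {n : ℕ} (z : Fin n → X × X) : Fin (n + n) → X :=
  Fin.append (fun i => (z i).1) (fun i => (z i).2)

lemma measurable_flatten {n : ℕ} : Measurable (flatten (X := X) (n := n)) := by
  refine measurable_pi_lambda _ fun k => ?_
  refine Fin.addCases (fun i => ?_) (fun i => ?_) k
  · simp only [flatten, Fin.append_left]
    exact (measurable_pi_apply i).fst
  · simp only [flatten, Fin.append_right]
    exact (measurable_pi_apply i).snd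

lemma patternLoss_flatten {X Y : Type*} (L : Y → Y → Bool) (f₀ f : X → Y) {n : ℕ}
    (z : Fin n → X × X) (i : Fin n) :
    patternLoss L (fun k => f (flatten z k)) (fun k => f₀ (flatten z k)) i =
      lossAt L f₀ f (z i).1 - lossAt L f₀ f (z i).2 := by
  simp only [patternLoss, flatten, Fin.append_left, Fin.append_right, lossAt]

lemma nullMeasurableSet_deviationSet [Finite Y] [DiscreteMeasurableSpace Y] {F : Set (X → Y)}
    (hF : WellBehaved F) (L : Y → Y → Bool) {f₀ : X → Y} (hf₀ : Measurable f₀) (n : ℕ) (t : ℝ)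
    (μ : Measure (Fin n → X × X)) [IsProbabilityMeasure μ] :
    NullMeasurableSet (deviationSet F L f₀ n t) μ := by
  have h : deviationSet F L f₀ n t =
      ⋃ p : Fin (n + n) → Y, ⋃ q : Fin (n + n) → Y,
        ⋃ _ : n * t < |∑ i, patternLoss L p q i|,
          {z | p ∈ patterns F (flatten z)} ∩ {z | (fun k => f₀ (flatten z k)) = q} := by
    ext z
    simp only [deviationSet, Set.mem_ofPred_eq, Set.mem_iUnion, Set.mem_inter_iff, exists_prop]
    constructor
    · rintro ⟨⟨f, hf⟩, h⟩
      refine ⟨fun k => f (flatten z k), _, ?_, ⟨f, hf, rfl⟩, rfl⟩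
      simpa only [patternLoss_flatten] using h
    · rintro ⟨_, _, h, ⟨f, hf, rfl⟩, rfl⟩
      refine ⟨⟨f, hf⟩, ?_⟩
      simpa only [patternLoss_flatten] using h
  rw [h]
  refine NullMeasurableSet.iUnion fun p => NullMeasurableSet.iUnion fun q =>
    NullMeasurableSet.iUnion fun _ => NullMeasurableSet.inter ?_ ?_
  · exact hF.nullMeasurableSet_preimage p μ measurable_flatten
  · exact (measurableSet_eq_fun (measurable_pi_lambda _ fun k =>
      hf₀.comp ((measurable_pi_apply k).comp measurable_flatten)) measurable_const).nullMeasurableSet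

lemma ncard_swapPairs_mem_deviationSet_le {X Y : Type*} [Finite Y] {F : Set (X → Y)}
    (L : Y → Y → Bool) (f₀ : X → Y) {n : ℕ} {t : ℝ} (ht : 0 ≤ t) {G : ℕ}
    (hG : growth F (n + n) ≤ G) (z : Fin n → X × X) :
    ((Set.ncard {σ : Fin n → Bool | swapPairs σ z ∈ deviationSet F L f₀ n t} : ℕ) : ℝ) ≤
      2 ^ n * (G * (2 * Real.exp (-(n * t ^ 2 / 2)))) := by
  classical
  let q : Fin (n + n) → Y := fun k => f₀ (flatten z k)
  let A := (Set.toFinite (patterns F (flatten z))).toFinset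
  have hA : A.card ≤ G := by
    have := (encard_patterns_le_growth F (flatten z)).trans hG
    rw [(Set.toFinite (patterns F (flatten z))).encard_eq_coe_toFinset_card] at this
    exact_mod_cast this
  have hsub : {σ : Fin n → Bool | swapPairs σ z ∈ deviationSet F L f₀ n t} ⊆
      (A.biUnion fun p => Finset.univ.filter fun σ : Fin n → Bool =>
        n * t < |∑ i, boolSign (σ i) * patternLoss L p q i| : Finset (Fin n → Bool)) := by
    rintro σ ⟨⟨f, hf⟩, h⟩
    simp only [Finset.coe_biUnion, Set.mem_iUnion, Finset.mem_coe, Finset.mem_filter,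
      Finset.mem_univ, true_and, exists_prop]
    refine ⟨fun k => f (flatten z k), (Set.Finite.mem_toFinset _).2 ⟨f, hf, rfl⟩, ?_⟩
    refine h.trans_eq (congrArg _ (Finset.sum_congr rfl fun i _ => ?_))
    rw [patternLoss_flatten]
    cases hσ : σ i <;> simp [boolSign, swapPairs, hσ]
  have h1 := Set.ncard_le_ncard hsub (Finset.finite_toSet _)
  rw [Set.ncard_coe_finset] at h1
  have h2 := h1.trans Finset.card_biUnion_le
  rw [← Nat.cast_le (α := ℝ)] at h2
  rw [Nat.cast_sum] at h2
  refine h2.trans ?_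
  calc _ ≤ ∑ _p ∈ A, (2 : ℝ) ^ n * (2 * Real.exp (-(n * t ^ 2 / 2))) :=
        Finset.sum_le_sum fun p _ =>
          card_lt_abs_sum_boolSign_le _ (abs_patternLoss_le L p q) ht
    _ = A.card * ((2 : ℝ) ^ n * (2 * Real.exp (-(n * t ^ 2 / 2)))) := by
        rw [Finset.sum_const, nsmul_eq_mul]
    _ ≤ G * ((2 : ℝ) ^ n * (2 * Real.exp (-(n * t ^ 2 / 2)))) := by gcongr
    _ = _ := by ring

/-- Empirical risk minimization learns a well-behaved class whose growth is small compared with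
`exp (n ε² / 32)`. -/
theorem sampleSizeSuffices_of_growth_le [Finite Y] [DiscreteMeasurableSpace Y] {F : Set (X → Y)}
    (hne : F.Nonempty) (hF : WellBehaved F) (L : Y → Y → Bool) {ε η : ℝ} (hε : 0 < ε) {n G : ℕ}
    (hn : 8 ≤ n * ε ^ 2) (hG : growth F (n + n) ≤ G)
    (hη : 4 * G * Real.exp (-(n * ε ^ 2 / 32)) ≤ η) : SampleSizeSuffices F L ε η n := by
  classical
  let err : (Fin n → X × Y) → (X → Y) → ℕ := fun z f =>
    (Finset.univ.filter fun i => L (f (z i).1) (z i).2 = true).card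
  refine ⟨fun z => Function.argminOn (err z) F hne, fun z => Function.argminOn_mem _ _ _, ?_⟩
  intro P _ f₀ hf₀
  have hlt : (0 : ℝ) < n := by
    by_contra h
    have : (n : ℝ) = 0 := le_antisymm (not_lt.1 h) (Nat.cast_nonneg n)
    rw [this] at hn
    norm_num at hn
  have hsub : {x : Fin n → X | ¬ ∀ g ∈ F,
      risk L P f₀ (Function.argminOn (err fun i => (x i, f₀ (x i))) F hne) - risk L P f₀ g ≤ ε} ⊆
      {x | ∃ f : F, n * (2 * (ε / 4)) <
        |∑ i, lossAt L f₀ f (x i) - n * ∫ y, lossAt L f₀ f y ∂P|} := by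
    intro x hx
    simp only [Set.mem_ofPred_eq] at hx ⊢
    by_contra! hcon
    refine hx fun g hg => ?_
    set fh := Function.argminOn (err fun i => (x i, f₀ (x i))) F hne
    have hfh : fh ∈ F := Function.argminOn_mem _ _ _
    have hle : err (fun i => (x i, f₀ (x i))) fh ≤ err (fun i => (x i, f₀ (x i))) g :=
      Function.argminOn_le _ F hg
    have hsum : ∀ f : X → Y, ((err (fun i => (x i, f₀ (x i))) f : ℕ) : ℝ) =
        ∑ i, lossAt L f₀ f (x i) := by
      intro f
      simp only [err, lossAt, Finset.cast_card, Finset.sum_filter]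
    have hle' : ∑ i, lossAt L f₀ fh (x i) ≤ ∑ i, lossAt L f₀ g (x i) := by
      rw [← hsum, ← hsum]
      exact_mod_cast hle
    have h1 := abs_le.1 (hcon ⟨fh, hfh⟩)
    have h2 := abs_le.1 (hcon ⟨g, hg⟩)
    change (∫ y, lossAt L f₀ fh y ∂P) - (∫ y, lossAt L f₀ g y ∂P) ≤ ε
    have h3 : n * ((∫ y, lossAt L f₀ fh y ∂P) - (∫ y, lossAt L f₀ g y ∂P)) ≤ n * ε := by
      dsimp only at h1 h2
      linarith [h1.1, h2.2]
    exact le_of_mul_le_mul_left h3 hlt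
  refine (measure_mono hsub).trans ?_
  refine (measure_deviation_le_two_mul P (u := fun f : F => lossAt L f₀ f)
    (fun f => measurable_lossAt L hf₀ (hF.1 f f.2)) (fun f x => lossAt_mem_Icc L f₀ f x)
    (t := ε / 4) (by positivity) (by nlinarith)).trans ?_
  have h := measure_le_of_card_swapPairs_le P
    (nullMeasurableSet_deviationSet hF L hf₀ n (ε / 4) _)
    (ncard_swapPairs_mem_deviationSet_le L f₀ (by positivity) hG)
  refine (mul_le_mul_right h 2).trans ?_
  rw [← ENNReal.ofReal_ofNat, ← ENNReal.ofReal_mul (by norm_num)]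
  refine ENNReal.ofReal_le_ofReal (le_trans (le_of_eq ?_) hη)
  rw [show (n : ℝ) * (ε / 4) ^ 2 / 2 = n * ε ^ 2 / 32 by ring]
  ring

end Learnability

section Measurability

variable {X B Q Γ : Type*} {a m M : ℕ}

lemma measurable_sigma_of_forall {ι β : Type*} {α : ι → Type*} [∀ i, MeasurableSpace (α i)]
    [MeasurableSpace β] {f : (Σ i, α i) → β} (h : ∀ i, Measurable fun x : α i => f ⟨i, x⟩) :
    Measurable f := by
  intro s hs
  exact MeasurableSpace.measurableSet_iInf.2 fun i => h i hs

lemma measurable_str_fst {A : Type*} [MeasurableSpace A] :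
    Measurable (fun s : Str A M => s.1) :=
  measurable_sigma_of_forall (α := fun n : Fin M => Fin ((n : ℕ) + 1) → A)
    fun _ => measurable_const

lemma Str.measurable_pad {A : Type*} [MeasurableSpace A] (a₀ : A) (j : Fin M) :
    Measurable (fun s : Str A M => s.pad a₀ j) := by
  refine measurable_sigma_of_forall (α := fun n : Fin M => Fin ((n : ℕ) + 1) → A) fun n => ?_
  by_cases h : (j : ℕ) < n + 1
  · simp only [Str.pad, h, dif_pos]
    exact measurable_pi_apply (⟨j, h⟩ : Fin ((n : ℕ) + 1))
  · simp only [Str.pad, h, not_false_eq_true, dif_neg]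
    exact measurable_const

lemma measurable_of_mem_projections [MeasurableSpace X] {p : (Fin a → X) → Fin m → X}
    (hp : p ∈ projections X a m) : Measurable p := by
  obtain ⟨J, hJ, rfl⟩ := hp
  exact measurable_pi_lambda _ fun i => measurable_pi_apply _

lemma wellBehaved_automataFunctions [Nonempty X] [Finite B] [Finite Γ]
    [MeasurableSpace X] [MeasurableSpace B] [MeasurableSpace Q] [MeasurableSpace Γ]
    [DiscreteMeasurableSpace B]
    {Φ : Set ((Fin m → X) → B)} {Δ : Set (Semiautomaton B Q)} (hΔ : Δ.Finite)
    {Θ : Set (Q × (Fin m → X) → Γ)} (hΦ : WellBehaved Φ) (hΘ : WellBehaved Θ) :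
    WellBehaved (automataFunctions a m M Φ Δ Θ) := by
  obtain ⟨a₀⟩ : Nonempty (Fin a → X) := inferInstance
  constructor
  · rintro _ ⟨𝔸, ⟨h1, -, h3⟩, rfl⟩
    have hφ := hΦ.1 _ h1
    have hp := measurable_of_mem_projections (X := X) ⟨𝔸.J, 𝔸.card_J, rfl⟩
    have hfun : 𝔸.induced.eval M = fun s => _ := funext fun s => 𝔸.eval_induced a₀ s
    beta_reduce
    rw [hfun]
    have hpad : ∀ (n j : Fin M), Measurable fun v : Fin ((n : ℕ) + 1) → Fin a → X =>
        Str.pad a₀ (⟨n, v⟩ : Str (Fin a → X) M) j := fun n j =>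
      (Str.measurable_pad a₀ j).comp (fun s hs => MeasurableSpace.measurableSet_iInf.1 hs n)
    refine measurable_sigma_of_forall fun n => (hΘ.1 _ h3).comp (Measurable.prodMk ?_ ?_)
    · exact (Measurable.of_discrete (f := fun b : Fin M → B => 𝔸.core.runPrefix b n)).comp
        (measurable_pi_lambda _ fun j => hφ.comp (hp.comp (hpad n j)))
    · exact hp.comp (hpad n n)
  · intro n q μ _
    have h : {x : Fin n → Str (Fin a → X) M | q ∈ patterns (automataFunctions a m M Φ Δ Θ) x} =
        ⋃ len : Fin n → Fin M, ⋃ p ∈ projections X a m, ⋃ D ∈ Δ, ⋃ b : Fin (n * M) → B,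
          ({x | (fun i => (x i).1) = len} ∩
          {x | b ∈ patterns Φ (fun k : Fin (n * M) =>
            p ((x (finProdFinEquiv.symm k).1).pad a₀ (finProdFinEquiv.symm k).2))}) ∩
          {x | q ∈ patterns Θ (fun i =>
            (D.runPrefix (fun j => b (finProdFinEquiv (i, j))) (len i),
              p ((x i).pad a₀ (len i))))} := by
      ext x
      simp only [Set.mem_ofPred_eq, mem_patterns_automataFunctions_iff a₀, Set.mem_iUnion,
        Set.mem_inter_iff, exists_prop]
      constructor
      · rintro ⟨p, hp, D, hD, b, hb, hq⟩
        exact ⟨_, p, hp, D, hD, b, ⟨rfl, hb⟩, hq⟩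
      · rintro ⟨_, p, hp, D, hD, b, ⟨rfl, hb⟩, hq⟩
        exact ⟨p, hp, D, hD, b, hb, hq⟩
    rw [h]
    refine NullMeasurableSet.iUnion fun len => NullMeasurableSet.biUnion
      (finite_projections X a m).countable fun p hp => NullMeasurableSet.biUnion hΔ.countable
      fun D _ => NullMeasurableSet.iUnion fun b => ?_
    have hp := measurable_of_mem_projections hp
    refine NullMeasurableSet.inter (NullMeasurableSet.inter ?_ ?_) ?_
    · refine (measurableSet_eq_fun (measurable_pi_lambda _ fun i => ?_)
        measurable_const).nullMeasurableSet
      exact measurable_str_fst.comp (measurable_pi_apply i)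
    · exact hΦ.nullMeasurableSet_preimage b μ (measurable_pi_lambda _ fun k =>
        hp.comp ((Str.measurable_pad a₀ _).comp (measurable_pi_apply _)))
    · exact hΘ.nullMeasurableSet_preimage q μ (measurable_pi_lambda _ fun i =>
        measurable_const.prodMk (hp.comp ((Str.measurable_pad a₀ _).comp (measurable_pi_apply _))))

end Measurability

section Numerics

lemma log_four_mul_div_exp_one_le {y : ℝ} (hy : 0 < y) :
    Real.log (4 * y / Real.exp 1) ≤ y * Real.log 2 := by
  have he := Real.exp_one_gt_d9
  have hl := Real.log_two_gt_d9
  rw [Real.log_le_iff_le_exp (by positivity), div_le_iff₀ (Real.exp_pos 1)]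
  have h1 : y * Real.log 2 ≤ Real.exp (y * Real.log 2 - 1) := by
    simpa using Real.add_one_le_exp (y * Real.log 2 - 1)
  have h2 : Real.exp (y * Real.log 2) = Real.exp 1 * Real.exp (y * Real.log 2 - 1) := by
    rw [← Real.exp_add]
    ring_nf
  have h3 : (4 : ℝ) ≤ Real.log 2 * (Real.exp 1 * Real.exp 1) := by nlinarith
  calc 4 * y ≤ Real.log 2 * (Real.exp 1 * Real.exp 1) * y := by gcongr
    _ = Real.exp 1 * (y * Real.log 2) * Real.exp 1 := by ring
    _ ≤ Real.exp (y * Real.log 2) * Real.exp 1 := by rw [h2]; gcongr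

/-- The solution of the inequality `2 ^ D ≤ (2 * D * N) ^ w`. -/
lemma le_two_mul_logb_of_two_pow_le {w N : ℝ} (hw : 0 < w) (hN : 0 < N) {D : ℕ} (hD : 1 ≤ D)
    (h : (2 : ℝ) ^ D ≤ Real.exp (w * Real.log (2 * D * N))) :
    (D : ℝ) ≤ 2 * w * Real.logb 2 (w * Real.exp 1 * N) := by
  have hD' : (0 : ℝ) < D := by exact_mod_cast hD
  have hl : 0 < Real.log 2 := Real.log_pos one_lt_two
  have h1 : D * Real.log 2 ≤ w * Real.log (2 * D * N) := by
    rw [← Real.log_pow]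
    exact (Real.log_le_iff_le_exp (by positivity)).2 h
  have h2 : Real.log (2 * D * N) =
      Real.log (4 * (D / (2 * w)) / Real.exp 1) + Real.log (w * Real.exp 1 * N) := by
    rw [← Real.log_mul (by positivity) (by positivity)]
    congr 1
    field_simp
    ring
  have h3 := log_four_mul_div_exp_one_le (y := D / (2 * w)) (by positivity)
  have h4 : w * Real.log (2 * D * N) ≤
      D * Real.log 2 / 2 + w * Real.log (w * Real.exp 1 * N) := by
    rw [h2, mul_add]
    have := mul_le_mul_of_nonneg_left h3 hw.le
    have h5 : w * (D / (2 * w) * Real.log 2) = D * Real.log 2 / 2 := by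
      field_simp
    linarith
  rw [Real.logb, ← mul_div_assoc, le_div_iff₀ hl]
  linarith

lemma mul_mul_pow_le_exp {p q x : ℝ} (hp : 1 ≤ p) (hq : 1 ≤ q) (hx : 2 ≤ x) (k : ℕ) :
    p * q * x ^ k ≤ Real.exp ((Real.logb 2 p + Real.logb 2 q + k) * Real.log x) := by
  have hx0 : 0 < x := by linarith
  have key : ∀ {r : ℝ}, 1 ≤ r → r ≤ Real.exp (Real.logb 2 r * Real.log x) := by
    intro r hr
    rw [← Real.log_le_iff_le_exp (by linarith)]
    have h1 : Real.log r = Real.logb 2 r * Real.log 2 := by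
      rw [Real.logb, div_mul_cancel₀ _ (Real.log_pos one_lt_two).ne']
    nth_rewrite 1 [h1]
    exact mul_le_mul_of_nonneg_left (Real.log_le_log two_pos hx)
      (Real.logb_nonneg one_lt_two hr)
  rw [add_mul, add_mul, Real.exp_add, Real.exp_add, Real.exp_nat_mul, Real.exp_log hx0]
  gcongr
  · exact key hp
  · exact key hq

lemma exists_sample_size {ε η : ℝ} (hε : 0 < ε) (hη : 0 < η) :
    ∃ K : ℝ, ∀ w N : ℝ, 2 ≤ w → 1 ≤ N → ∃ n : ℕ, 1 ≤ n ∧ 8 ≤ n * ε ^ 2 ∧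
      4 * Real.exp (w * Real.log (4 * n * N)) * Real.exp (-(n * ε ^ 2 / 32)) ≤ η ∧
      (n : ℝ) ≤ K * (w * Real.logb 2 (w * N)) := by
  set c := ε ^ 2 / 32 with hc
  have hc0 : 0 < c := by positivity
  set A := |Real.log 4 - Real.log η| + |Real.log (8 / c)| + 1 with hA
  have hA0 : 0 < A := by positivity
  refine ⟨2 / c * A + 8 / ε ^ 2 + 1, fun w N hw hN => ?_⟩
  set T := w * Real.logb 2 (w * N)
  have hwN : 2 ≤ w * N := by nlinarith
  have hL : 1 ≤ Real.logb 2 (w * N) := by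
    rw [Real.le_logb_iff_rpow_le one_lt_two (by linarith), Real.rpow_one]
    exact hwN
  have hwT : w ≤ T := le_mul_of_one_le_right (by linarith) hL
  have hT : 1 ≤ T := by linarith
  have hlog : Real.log (w * N) ≤ Real.logb 2 (w * N) := by
    rw [Real.logb, le_div_iff₀ (Real.log_pos one_lt_two)]
    exact mul_le_of_le_one_right (Real.log_nonneg (by linarith)) (by linarith [Real.log_two_lt_d9])
  set n := ⌈(2 / c * A + 8 / ε ^ 2) * T⌉₊
  have hn : (2 / c * A + 8 / ε ^ 2) * T ≤ n := Nat.le_ceil _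
  have hn0 : (0 : ℝ) < n := lt_of_lt_of_le (by positivity) hn
  have hn1 : 2 / c * A * T ≤ n := le_trans (by gcongr; linarith [show 0 < 8 / ε ^ 2 by positivity]) hn
  have hn2 : 8 / ε ^ 2 ≤ n := by
    refine le_trans ?_ hn
    have : 0 < 2 / c * A := by positivity
    have : 0 < 8 / ε ^ 2 := by positivity
    nlinarith
  refine ⟨n, by exact_mod_cast hn0, ?_, ?_, ?_⟩
  · rwa [div_le_iff₀ (by positivity)] at hn2
  · have h1 : Real.log (4 * n * N) =
        Real.log (c / 2 * n / w) + Real.log (8 / c) + Real.log (w * N) := by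
      rw [← Real.log_mul (by positivity) (by positivity),
        ← Real.log_mul (by positivity) (by positivity)]
      congr 1
      field_simp
      ring
    have h2 : Real.log (c / 2 * n / w) ≤ c / 2 * n / w :=
      (Real.log_le_sub_one_of_pos (by positivity)).trans (by linarith)
    have h3 : w * Real.log (4 * n * N) ≤ c / 2 * n + |Real.log (8 / c)| * T + T := by
      rw [h1, mul_add, mul_add]
      have e1 : w * Real.log (c / 2 * n / w) ≤ c / 2 * n := by
        refine (mul_le_mul_of_nonneg_left h2 (by linarith)).trans (le_of_eq ?_)
        field_simp
      have e2 : w * Real.log (8 / c) ≤ |Real.log (8 / c)| * T := by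
        rw [mul_comm]
        exact mul_le_mul (le_abs_self _) hwT (by linarith) (abs_nonneg _)
      have e3 : w * Real.log (w * N) ≤ T := mul_le_mul_of_nonneg_left hlog (by linarith)
      linarith
    have h4 : A * T ≤ c / 2 * n := by
      have := mul_le_mul_of_nonneg_left hn1 (show 0 ≤ c / 2 by positivity)
      refine le_trans (le_of_eq ?_) this
      field_simp
    have h5 : Real.log 4 - Real.log η ≤ |Real.log 4 - Real.log η| * T :=
      (le_abs_self _).trans (le_mul_of_one_le_right (abs_nonneg _) hT)
    have h6 : Real.log 4 + w * Real.log (4 * n * N) + -(n * ε ^ 2 / 32) ≤ Real.log η := by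
      have h7 : n * ε ^ 2 / 32 = c * n := by rw [hc]; ring
      rw [h7]
      rw [hA] at h4
      linarith
    calc _ = Real.exp (Real.log 4 + w * Real.log (4 * n * N) + -(n * ε ^ 2 / 32)) := by
          rw [Real.exp_add, Real.exp_add, Real.exp_log (by norm_num)]
      _ ≤ Real.exp (Real.log η) := Real.exp_le_exp.2 h6
      _ = η := Real.exp_log hη
  · have := (Nat.ceil_lt_add_one (a := (2 / c * A + 8 / ε ^ 2) * T) (by positivity)).le
    rw [add_mul _ 1 T, one_mul]
    exact this.trans (by linarith)

end Numerics

theorem mainTheorem3 (ε η : ℝ) (hε : 0 < ε) (hη : 0 < η) :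
    ∃ K : ℝ, ∀ (X : Type*) (B : Type*) (Q : Type*) (Γ : Type*)
      [Nonempty X] [Finite B] [Finite Q] [Finite Γ]
      (a m M : ℕ) (Φ : Set ((Fin m → X) → B)) (Δ : Set (Semiautomaton B Q))
      (Θ : Set (Q × (Fin m → X) → Γ)),
      1 ≤ a → m ≤ a → 1 ≤ M → Φ.Nonempty → Δ.Nonempty → Δ.Finite → Θ.Nonempty →
      (∀ l : ℕ, growth (automataFunctions a m M Φ Δ Θ) l ≤
        ((projections X a m).ncard : ℕ∞) * (Δ.ncard : ℕ∞) * growth Φ (l * M) * growth Θ l) ∧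
      ∀ (h g : ℕ) (w : ℝ), dimension Φ = h → dimension Θ = g →
        w = Real.logb 2 ((projections X a m).ncard : ℝ) + Real.logb 2 (Δ.ncard : ℝ) + h + g →
        2 ≤ w →
        (∃ d : ℕ, dimension (automataFunctions a m M Φ Δ Θ) = d ∧
          (d : ℝ) ≤ 2 * w * Real.logb 2
            (w * Real.exp 1 * (M : ℝ) * (Nat.card B : ℝ) * (Nat.card Γ : ℝ))) ∧
        ∀ [MeasurableSpace X] [MeasurableSpace B] [MeasurableSpace Q] [MeasurableSpace Γ]
          [DiscreteMeasurableSpace B] [DiscreteMeasurableSpace Q] [DiscreteMeasurableSpace Γ],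
          WellBehaved Φ → WellBehaved Θ → ∀ L : Γ → Γ → Bool,
          ∃ s : ℕ, sampleComplexity (automataFunctions a m M Φ Δ Θ) L ε η = s ∧
            (s : ℝ) ≤ K * (w * Real.logb 2
              (w * (M : ℝ) * (Nat.card B : ℝ) * (Nat.card Γ : ℝ))) := by
  obtain ⟨K, hK⟩ := exists_sample_size hε hη
  refine ⟨K, ?_⟩
  intro X B Q Γ _ _ _ _ a m M Φ Δ Θ _ hm hM hΦ hΔ hΔf hΘ
  refine ⟨growth_automataFunctions_le Φ hΔf Θ, ?_⟩
  intro h g w hh hg hw hw2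
  obtain ⟨x₀⟩ : Nonempty (Fin m → X) := inferInstance
  have hBne : Nonempty B := ⟨hΦ.some x₀⟩
  have hΓne : Nonempty Γ := ⟨hΘ.some (hΔ.some.init, x₀)⟩
  set 𝓕 := automataFunctions a m M Φ Δ Θ
  have hne : 𝓕.Nonempty := nonempty_automataFunctions hm hΦ hΔ hΘ
  set p := (projections X a m).ncard
  set q := Δ.ncard
  set N := M * Nat.card B * Nat.card Γ with hN
  have hp : 1 ≤ p := (Set.ncard_pos (finite_projections X a m)).2 (nonempty_projections X hm)
  have hq : 1 ≤ q := (Set.ncard_pos hΔf).2 hΔ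
  have hN1 : 1 ≤ N := Nat.mul_pos (Nat.mul_pos hM Nat.card_pos) Nat.card_pos
  have hNR : (1 : ℝ) ≤ N := by exact_mod_cast hN1
  have hgrowth : ∀ {l : ℕ}, 1 ≤ l → growth 𝓕 l ≤ ((p * q * (2 * l * N) ^ (h + g) : ℕ) : ℕ∞) :=
    fun hl => growth_automataFunctions_le_of_dimension hM hΦ hΔ hΔf hΘ hh hg hl
  have hexp : ∀ {l : ℕ}, 1 ≤ l → ((p * q * (2 * l * N) ^ (h + g) : ℕ) : ℝ) ≤
      Real.exp (w * Real.log (2 * l * N)) := by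
    intro l hl
    have hl' : (1 : ℝ) ≤ l := by exact_mod_cast hl
    have := mul_mul_pow_le_exp (p := p) (q := q) (x := 2 * l * N) (by exact_mod_cast hp)
      (by exact_mod_cast hq) (by nlinarith) (h + g)
    rw [hw]
    push_cast at this ⊢
    rwa [add_assoc _ (h : ℝ)]
  have hbound : ∀ D : ℕ, 2 ^ D ≤ growth 𝓕 D →
      (D : ℝ) ≤ 2 * w * Real.logb 2
        (w * Real.exp 1 * (M : ℝ) * (Nat.card B : ℝ) * (Nat.card Γ : ℝ)) := by
    intro D hD
    have hNeq : w * Real.exp 1 * (M : ℝ) * (Nat.card B : ℝ) * (Nat.card Γ : ℝ) =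
        w * Real.exp 1 * N := by
      rw [hN]
      push_cast
      ring
    rw [hNeq]
    rcases Nat.eq_zero_or_pos D with rfl | hD0
    · have : 1 ≤ w * Real.exp 1 * N := by
        have := Real.add_one_le_exp 1
        have : 1 ≤ w * Real.exp 1 := by nlinarith
        nlinarith
      have := Real.logb_nonneg one_lt_two this
      rw [Nat.cast_zero]
      positivity
    · refine le_two_mul_logb_of_two_pow_le (by linarith) (by linarith) hD0
        (le_trans ?_ (hexp hD0))
      have := hD.trans (hgrowth hD0)
      exact_mod_cast this
  refine ⟨?_, ?_⟩
  · rcases hd : dimension 𝓕 with _ | d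
    · exfalso
      obtain ⟨D, hD⟩ := exists_nat_gt (2 * w * Real.logb 2
        (w * Real.exp 1 * (M : ℝ) * (Nat.card B : ℝ) * (Nat.card Γ : ℝ)))
      exact absurd (hbound D (two_pow_le_growth_of_dimension_eq_top hne hd D)) (not_le.2 hD)
    · exact ⟨d, rfl, hbound d (two_pow_le_growth_of_dimension_eq hd)⟩
  · intro _ _ _ _ _ _ _ hΦw hΘw L
    obtain ⟨n, hn1, hn8, hnη, hnK⟩ := hK w N hw2 hNR
    have hn2 : 1 ≤ n + n := by omega
    have hsuff : SampleSizeSuffices 𝓕 L ε η n := by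
      refine sampleSizeSuffices_of_growth_le hne
        (wellBehaved_automataFunctions hΔf hΦw hΘw) L hε hn8 (hgrowth hn2) ?_
      refine le_trans ?_ hnη
      have := hexp hn2
      rw [show (2 : ℝ) * (n + n : ℕ) * N = 4 * n * N by push_cast; ring] at this
      gcongr
    have hle : sampleComplexity 𝓕 L ε η ≤ n := iInf₂_le n hsuff
    obtain ⟨s, hs⟩ := ENat.ne_top_iff_exists.1 (ne_top_of_le_ne_top (ENat.natCast_ne_top n) hle)
    refine ⟨s, hs.symm, ?_⟩
    rw [← hs] at hle
    have hsn : (s : ℝ) ≤ n := by exact_mod_cast hle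
    refine hsn.trans (hnK.trans (le_of_eq ?_))
    rw [hN]
    push_cast
    ring_nf
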